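/- Let $n\ge 3$, let $\mathbb B^n$ and $\mathbb S^{n-1}$ be the open unit ball and the unit sphere of $\mathbb R^n$, and let $\sigma$ be the normalized surface measure on $\mathbb S^{n-1}$. For $\phi\in L^1(\mathbb S^{n-1},\mathbb R)$ let $$\mathcal P_h[\phi](x)=\int_{\mathbb S^{n-1}}\left(\frac{1-|x|^2}{|x-\zeta|^2}\right)^{n-1}\phi(\zeta)\,d\sigma(\zeta),\qquad x\in\mathbb B^n,$$ be its invariant (hyperbolic) Poisson integral. Let $p\in(1,\infty]$ and $x\in\mathbb B^n\setminus\{0\}$. For $\ell\in\mathbb S^{n-1}$ let $C_p(x;\ell)$ and $C_p(x)$ be the smallest real numbers such that, for every $\phi\in L^p(\mathbb S^{n-1},\mathbb R)$ and $u=\mathcal P_h[\phi]$, $$|\langle\nabla u(x),\ell\rangle|\le C_p(x;\ell)\,\|\phi\|_{L^p(\sigma)},\qquad |\nabla u(x)|\le C_p(x)\,\|\phi\|_{L^p(\sigma)} .$$ Put $n_x=x/|x|$ and let $t_x$ denote an arbitrary unit vector with $\langle t_x,x\rangle=0$. Theorem. Every such $u$ is differentiable at $x$, the smallest numbers $C_p(x;\ell)$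 and $C_p(x)$ exist, and the following hold. 1. If $1<p<n$, then $\max_{\ell\in\mathbb S^{n-1}}C_p(x;\ell)=C_p(x;n_x)$, $\min_{\ell\in\mathbb S^{n-1}}C_p(x;\ell)=C_p(x;t_x)$, and $C_p(x)=C_p(x;n_x)$. 2. If $p>n$, then $\max_{\ell\in\mathbb S^{n-1}}C_p(x;\ell)=C_p(x;t_x)$, $\min_{\ell\in\mathbb S^{n-1}}C_p(x;\ell)=C_p(x;n_x)$, and $C_p(x)=C_p(x;t_x)$. 3. If $p=n$ or $p=\infty$, then $\ell\mapsto C_p(x;\ell)$ is constant on $\mathbb S^{n-1}$, and $C_p(x)=C_p(x;\ell)$ for every $\ell\in\mathbb S^{n-1}$. -/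

import Mathlib

open MeasureTheory
open scoped ENNReal

namespace HypKhavinson

/-- The normalized surface measure `σ` on the unit sphere of `ℝⁿ`. -/
noncomputable def sphereMeasure (n : ℕ) :
    Measure (Metric.sphere (0 : EuclideanSpace ℝ (Fin n)) 1) :=
  ((volume : Measure (EuclideanSpace ℝ (Fin n))).toSphere Set.univ)⁻¹ •
    (volume : Measure (EuclideanSpace ℝ (Fin n))).toSphere

/-- The Poisson kernel `P_h(x, ζ) = ((1 - |x|²) / |x - ζ|²)^(n-1)` of the hyperbolic Laplacian. -/
noncomputable def poissonKernel {n : ℕ} (x ζ : EuclideanSpace ℝ (Fin n)) : ℝ :=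
  ((1 - ‖x‖ ^ 2) / ‖x - ζ‖ ^ 2) ^ (n - 1)

/-- The invariant Poisson integral `P_h[φ](x) = ∫ P_h(x, ζ) φ(ζ) dσ(ζ)`. -/
noncomputable def poissonIntegral {n : ℕ}
    (φ : Metric.sphere (0 : EuclideanSpace ℝ (Fin n)) 1 → ℝ)
    (x : EuclideanSpace ℝ (Fin n)) : ℝ :=
  ∫ ζ, poissonKernel x (ζ : EuclideanSpace ℝ (Fin n)) * φ ζ ∂(sphereMeasure n)

/-- The numbers `C` with `|⟨∇u(x), ℓ⟩| ≤ C ‖φ‖_p` for all `u = P_h[φ]`, `φ ∈ L^p`. -/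
def dirBounds {n : ℕ} (p : ℝ≥0∞) (x ℓ : EuclideanSpace ℝ (Fin n)) : Set ℝ :=
  {C | ∀ φ : Metric.sphere (0 : EuclideanSpace ℝ (Fin n)) 1 → ℝ,
    MemLp φ p (sphereMeasure n) →
      |inner ℝ (gradient (poissonIntegral φ) x) ℓ| ≤ C * (eLpNorm φ p (sphereMeasure n)).toReal}

/-- The numbers `C` with `|∇u(x)| ≤ C ‖φ‖_p` for all `u = P_h[φ]`, `φ ∈ L^p`. -/
def gradBounds {n : ℕ} (p : ℝ≥0∞) (x : EuclideanSpace ℝ (Fin n)) : Set ℝ :=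
  {C | ∀ φ : Metric.sphere (0 : EuclideanSpace ℝ (Fin n)) 1 → ℝ,
    MemLp φ p (sphereMeasure n) →
      ‖gradient (poissonIntegral φ) x‖ ≤ C * (eLpNorm φ p (sphereMeasure n)).toReal}

/-- The optimal directional constant `C_p(x; ℓ)`. -/
noncomputable def dirConst {n : ℕ} (p : ℝ≥0∞) (x ℓ : EuclideanSpace ℝ (Fin n)) : ℝ :=
  sInf (dirBounds p x ℓ)

/-- The optimal gradient constant `C_p(x)`. -/
noncomputable def gradConst {n : ℕ} (p : ℝ≥0∞) (x : EuclideanSpace ℝ (Fin n)) : ℝ :=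
  sInf (gradBounds p x)

end HypKhavinson

open HypKhavinson

namespace HypKhavinson

open Metric Set Module

section Polar

variable {n : ℕ}

instance (n : ℕ) [NeZero n] : IsProbabilityMeasure (sphereMeasure n) := by
  constructor
  have h : (volume : Measure (EuclideanSpace ℝ (Fin n))).toSphere ≠ 0 :=
    Measure.toSphere_ne_zero _
  rw [sphereMeasure, Measure.smul_apply, smul_eq_mul]
  exact ENNReal.inv_mul_cancel (Measure.measure_univ_ne_zero.2 h) (measure_ne_top _ _)

/-- Integration over the sphere in terms of integration of `0`-homogeneous functions
over the unit ball. -/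
theorem exists_integral_sphereMeasure (n : ℕ) [NeZero n] :
    ∃ c : ℝ, ∀ g : EuclideanSpace ℝ (Fin n) → ℝ,
      ∫ ζ, g ζ ∂(sphereMeasure n) = c * ∫ y in ball 0 1 \ {0}, g (‖y‖⁻¹ • y) := by
  set E := EuclideanSpace ℝ (Fin n)
  set μ : Measure E := volume
  set ν := Measure.volumeIoiPow (finrank ℝ E - 1)
  set I : ℝ := ∫ r : Ioi (0 : ℝ), (Iio (1 : ℝ)).indicator 1 (r : ℝ) ∂ν
  have hI : I ≠ 0 := by
    have h1 : I = ν.real (Iio ⟨1, mem_Ioi.2 one_pos⟩) := by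
      rw [← integral_indicator_one measurableSet_Iio]
      rfl
    rw [h1, measureReal_def, Measure.volumeIoiPow_apply_Iio, ENNReal.toReal_ofReal (by positivity)]
    positivity
  have key : ∀ g : E → ℝ,
      ∫ y in ball 0 1 \ {0}, g (‖y‖⁻¹ • y) ∂μ = (∫ ζ, g ζ ∂μ.toSphere) * I := by
    intro g
    calc ∫ y in ball 0 1 \ {0}, g (‖y‖⁻¹ • y) ∂μ
        = ∫ y in {0}ᶜ, g (‖y‖⁻¹ • y) * (Iio (1 : ℝ)).indicator 1 ‖y‖ ∂μ := by
          rw [← integral_indicator (measurableSet_ball.diff (measurableSet_singleton _)),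
            ← integral_indicator (measurableSet_singleton _).compl]
          congr 1
          ext y
          by_cases h0 : y = 0 <;> by_cases h1 : ‖y‖ < 1 <;> simp [indicator, h0, h1]
      _ = ∫ y : ({(0)}ᶜ : Set E), g (‖y.1‖⁻¹ • y.1) * (Iio (1 : ℝ)).indicator 1 ‖y.1‖
            ∂(μ.comap (↑)) := by
          rw [integral_subtype_comap (measurableSet_singleton _).compl
            fun y : E ↦ g (‖y‖⁻¹ • y) * (Iio (1 : ℝ)).indicator 1 ‖y‖]
      _ = ∫ z, g z.1 * (Iio (1 : ℝ)).indicator 1 (z.2 : ℝ) ∂μ.toSphere.prod ν := by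
          simpa using μ.measurePreserving_homeomorphUnitSphereProd.integral_comp
            (Homeomorph.measurableEmbedding _)
            (fun z ↦ g z.1 * (Iio (1 : ℝ)).indicator 1 (z.2 : ℝ))
      _ = _ := integral_prod_mul (fun ζ : sphere (0 : E) 1 ↦ g ζ)
          (fun r : Ioi (0 : ℝ) ↦ (Iio (1 : ℝ)).indicator 1 (r : ℝ))
  refine ⟨((μ.toSphere univ)⁻¹).toReal * I⁻¹, fun g ↦ ?_⟩
  rw [key, sphereMeasure, integral_smul_measure, smul_eq_mul, mul_assoc, mul_comm _ I,
    inv_mul_cancel_left₀ hI]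

theorem integral_sphereMeasure_comp_isometry [NeZero n]
    (R : EuclideanSpace ℝ (Fin n) ≃ₗᵢ[ℝ] EuclideanSpace ℝ (Fin n))
    (g : EuclideanSpace ℝ (Fin n) → ℝ) :
    ∫ ζ, g (R ζ) ∂(sphereMeasure n) = ∫ ζ, g ζ ∂(sphereMeasure n) := by
  obtain ⟨c, hc⟩ := exists_integral_sphereMeasure n
  rw [hc g, hc fun y ↦ g (R y)]
  congr 1
  have h := R.measurePreserving.setIntegral_preimage_emb R.toHomeomorph.measurableEmbedding
    (fun y ↦ g (‖y‖⁻¹ • y)) (ball 0 1 \ {0})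
  rw [← h]
  have hpre : R ⁻¹' (ball 0 1 \ {0}) = ball 0 1 \ {0} := by
    ext y
    simp
  simp [hpre]

end Polar

section Moebius

variable {E : Type*} [NormedAddCommGroup E] [InnerProductSpace ℝ E]

/-- The conformal map of the unit sphere that is a translate of an inversion centred at `x`. -/
noncomputable def sphereMoebius (x ζ : E) : E :=
  -x + ((1 - ‖x‖ ^ 2) / ‖ζ - x‖ ^ 2) • (ζ - x)

theorem sphereMoebius_eq_inversion {x : E} (hx : ‖x‖ < 1) (ζ : E) :
    sphereMoebius x ζ = EuclideanGeometry.inversion x (√(1 - ‖x‖ ^ 2)) ζ - (2 : ℝ) • x := by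
  have h : 0 ≤ 1 - ‖x‖ ^ 2 := by nlinarith [norm_nonneg x]
  rw [EuclideanGeometry.inversion, div_pow, Real.sq_sqrt h, dist_eq_norm, sphereMoebius]
  simp only [vsub_eq_sub, vadd_eq_add]
  module

omit [InnerProductSpace ℝ E] in
theorem sub_ne_zero_of_norm {x ζ : E} (hx : ‖x‖ < 1) (hζ : ‖ζ‖ = 1) : ‖ζ - x‖ ≠ 0 := by
  rw [norm_ne_zero_iff, sub_ne_zero]
  rintro rfl
  linarith

theorem norm_sub_sq_of_norm {x ζ : E} (hζ : ‖ζ‖ = 1) :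
    ‖ζ - x‖ ^ 2 = 1 + ‖x‖ ^ 2 - 2 * inner ℝ ζ x := by
  rw [norm_sub_sq_real, hζ]
  ring

theorem inner_sub_self_of_norm {x ζ : E} (hζ : ‖ζ‖ = 1) :
    2 * inner ℝ (ζ - x) x = 1 - ‖x‖ ^ 2 - ‖ζ - x‖ ^ 2 := by
  rw [norm_sub_sq_of_norm hζ, inner_sub_left, real_inner_self_eq_norm_sq]
  ring

theorem norm_sphereMoebius {x ζ : E} (hx : ‖x‖ < 1) (hζ : ‖ζ‖ = 1) : ‖sphereMoebius x ζ‖ = 1 := by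
  have h := sub_ne_zero_of_norm hx hζ
  have : ‖sphereMoebius x ζ‖ ^ 2 = 1 := by
    rw [sphereMoebius, norm_add_sq_real, norm_neg, norm_smul, mul_pow, inner_neg_left,
      inner_smul_right, real_inner_comm, Real.norm_eq_abs, sq_abs]
    have h2 := inner_sub_self_of_norm (x := x) hζ
    field_simp
    linear_combination (-(1 - ‖x‖ ^ 2)) * h2
  exact (pow_eq_one_iff_of_nonneg (norm_nonneg _) two_ne_zero).1 this

theorem norm_sphereMoebius_add_sq {x ζ : E} (hx : ‖x‖ < 1) (hζ : ‖ζ‖ = 1) :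
    ‖sphereMoebius x ζ + x‖ ^ 2 = (1 - ‖x‖ ^ 2) ^ 2 / ‖ζ - x‖ ^ 2 := by
  have h := sub_ne_zero_of_norm hx hζ
  rw [sphereMoebius, neg_add_cancel_comm, norm_smul, mul_pow, Real.norm_eq_abs, sq_abs]
  field_simp

theorem sphereMoebius_neg_sphereMoebius {x ζ : E} (hx : ‖x‖ < 1) (hζ : ‖ζ‖ = 1) :
    sphereMoebius (-x) (sphereMoebius x ζ) = ζ := by
  have h := sub_ne_zero_of_norm hx hζ
  have h1 : 1 - ‖x‖ ^ 2 ≠ 0 := by nlinarith [norm_nonneg x]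
  rw [sphereMoebius, sub_neg_eq_add, norm_sphereMoebius_add_sq hx hζ, neg_neg, norm_neg,
    sphereMoebius, neg_add_cancel_comm, smul_smul]
  have : (1 - ‖x‖ ^ 2) / ((1 - ‖x‖ ^ 2) ^ 2 / ‖ζ - x‖ ^ 2) * ((1 - ‖x‖ ^ 2) / ‖ζ - x‖ ^ 2) = 1 := by
    field_simp
  rw [this, one_smul]
  abel

theorem reflection_sub_apply {x ζ : E} (hx : ‖x‖ < 1) (hζ : ‖ζ‖ = 1) :
    (ℝ ∙ (ζ - x))ᗮ.reflection ζ = -sphereMoebius x ζ := by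
  have h := sub_ne_zero_of_norm hx hζ
  rw [Submodule.reflection_orthogonal_apply, Submodule.reflection_singleton_apply, sphereMoebius]
  have h2 : 2 * inner ℝ (ζ - x) ζ = ‖ζ - x‖ ^ 2 + (1 - ‖x‖ ^ 2) := by
    have h3 := real_inner_self_eq_norm_sq (ζ - x)
    have h4 := inner_sub_self_of_norm (x := x) hζ
    rw [inner_sub_right] at h3
    linarith
  have h5 : (2 : ℝ) * (inner ℝ (ζ - x) ζ / ‖ζ - x‖ ^ 2) = 1 + (1 - ‖x‖ ^ 2) / ‖ζ - x‖ ^ 2 := by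
    field_simp
    linarith
  have h6 : (2 : ℕ) • (inner ℝ (ζ - x) ζ / ‖ζ - x‖ ^ 2) • (ζ - x)
      = (1 + (1 - ‖x‖ ^ 2) / ‖ζ - x‖ ^ 2) • (ζ - x) := by
    rw [← h5]; module
  simp only [RCLike.ofReal_real_eq_id, id_eq] at *
  rw [h6]
  module

/-- The radial extension of `sphereMoebius`. -/
noncomputable def coneMoebius (x y : E) : E := ‖y‖ • sphereMoebius x (‖y‖⁻¹ • y)

theorem norm_inv_smul_self {y : E} (hy : y ≠ 0) : ‖‖y‖⁻¹ • y‖ = 1 :=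
  norm_smul_inv_norm (𝕜 := ℝ) hy

theorem norm_coneMoebius {x y : E} (hx : ‖x‖ < 1) (hy : y ≠ 0) : ‖coneMoebius x y‖ = ‖y‖ := by
  rw [coneMoebius, norm_smul, norm_norm, norm_sphereMoebius hx (norm_inv_smul_self hy), mul_one]

theorem inv_norm_smul_coneMoebius {x y : E} (hx : ‖x‖ < 1) (hy : y ≠ 0) :
    ‖coneMoebius x y‖⁻¹ • coneMoebius x y = sphereMoebius x (‖y‖⁻¹ • y) := by
  rw [norm_coneMoebius hx hy, coneMoebius, inv_smul_smul₀ (norm_ne_zero_iff.2 hy)]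

theorem coneMoebius_neg_coneMoebius {x y : E} (hx : ‖x‖ < 1) (hy : y ≠ 0) :
    coneMoebius (-x) (coneMoebius x y) = y := by
  conv_lhs => rw [coneMoebius]
  rw [inv_norm_smul_coneMoebius hx hy, sphereMoebius_neg_sphereMoebius hx (norm_inv_smul_self hy),
    norm_coneMoebius hx hy, smul_inv_smul₀ (norm_ne_zero_iff.2 hy)]

theorem coneMoebius_ne_zero {x y : E} (hx : ‖x‖ < 1) (hy : y ≠ 0) : coneMoebius x y ≠ 0 := by
  rw [← norm_ne_zero_iff, norm_coneMoebius hx hy]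
  exact norm_ne_zero_iff.2 hy

theorem coneMoebius_image {x : E} (hx : ‖x‖ < 1) :
    coneMoebius x '' (ball 0 1 \ {0}) = ball 0 1 \ {0} := by
  have maps : ∀ x : E, ‖x‖ < 1 → ∀ y ∈ ball (0 : E) 1 \ {0}, coneMoebius x y ∈ ball 0 1 \ {0} := by
    intro x hx y ⟨hy1, hy0⟩
    exact ⟨by simpa [norm_coneMoebius hx hy0] using hy1, coneMoebius_ne_zero hx hy0⟩
  apply Subset.antisymm
  · rintro _ ⟨y, hy, rfl⟩
    exact maps x hx y hy
  · intro y hy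
    refine ⟨coneMoebius (-x) y, maps (-x) (by simpa) y hy, ?_⟩
    simpa using coneMoebius_neg_coneMoebius (x := -x) (by simpa) hy.2

/-- The derivative of `coneMoebius x` at `y`. -/
noncomputable def coneMoebiusDeriv (x y : E) : E →L[ℝ] E :=
  ‖y‖ • ((((1 - ‖x‖ ^ 2) / ‖‖y‖⁻¹ • y - x‖ ^ 2) •
      ((ℝ ∙ (‖y‖⁻¹ • y - x))ᗮ.reflection : E →L[ℝ] E)) ∘L
    (‖y‖⁻¹ • ContinuousLinearMap.id ℝ E -
      (‖y‖⁻¹ • (‖y‖⁻¹ • innerSL ℝ (‖y‖⁻¹ • y))).smulRight y)) +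
  (innerSL ℝ (‖y‖⁻¹ • y)).smulRight (sphereMoebius x (‖y‖⁻¹ • y))

theorem hasFDerivAt_norm {y : E} (hy : y ≠ 0) :
    HasFDerivAt (fun z : E ↦ ‖z‖) (innerSL ℝ (‖y‖⁻¹ • y)) y := by
  have h := (hasStrictFDerivAt_norm_sq y).hasFDerivAt.sqrt (by simpa using hy)
  simp only [Real.sqrt_sq (norm_nonneg _)] at h
  refine h.congr_fderiv ?_
  ext v
  simp only [_root_.smul_apply, innerSL_apply_apply, inner_smul_left, smul_eq_mul,
    nsmul_eq_mul]
  simp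
  field_simp

theorem hasFDerivAt_coneMoebius {x y : E} (hx : ‖x‖ < 1) (hy : y ≠ 0) :
    HasFDerivAt (coneMoebius x) (coneMoebiusDeriv x y) y := by
  have hn := hasFDerivAt_norm hy
  have hy' := norm_ne_zero_iff.2 hy
  have h1 : HasFDerivAt (fun z : E ↦ ‖z‖⁻¹ • z)
      (‖y‖⁻¹ • ContinuousLinearMap.id ℝ E -
        (‖y‖⁻¹ • (‖y‖⁻¹ • innerSL ℝ (‖y‖⁻¹ • y))).smulRight y) y := by
    refine (((hasDerivAt_inv hy').comp_hasFDerivAt y hn).smul (hasFDerivAt_id y)).congr_fderiv ?_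
    ext v
    simp
    field_simp
    module
  have h2 : HasFDerivAt (sphereMoebius x)
      (((1 - ‖x‖ ^ 2) / ‖‖y‖⁻¹ • y - x‖ ^ 2) •
        ((ℝ ∙ (‖y‖⁻¹ • y - x))ᗮ.reflection : E →L[ℝ] E)) (‖y‖⁻¹ • y) := by
    have hne : ‖y‖⁻¹ • y ≠ x := by
      intro h
      have := norm_inv_smul_self hy
      rw [h] at this
      linarith
    have h := (EuclideanGeometry.hasFDerivAt_inversion (R := √(1 - ‖x‖ ^ 2)) hne).sub_const
      ((2 : ℝ) • x)
    have h0 : 0 ≤ 1 - ‖x‖ ^ 2 := by nlinarith [norm_nonneg x]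
    rw [div_pow, Real.sq_sqrt h0, dist_eq_norm] at h
    exact h.congr_of_eventuallyEq (.of_forall fun ζ ↦ sphereMoebius_eq_inversion hx ζ)
  exact hn.smul (HasFDerivAt.comp (f := fun z : E ↦ ‖z‖⁻¹ • z) y h2 h1)

theorem coneMoebiusDeriv_eq {x y : E} (hx : ‖x‖ < 1) (hy : y ≠ 0) :
    (coneMoebiusDeriv x y : E →ₗ[ℝ] E) =
      ((ℝ ∙ (‖y‖⁻¹ • y - x))ᗮ.reflection.toLinearEquiv : E →ₗ[ℝ] E) ∘ₗ
        (((1 - ‖x‖ ^ 2) / ‖‖y‖⁻¹ • y - x‖ ^ 2) •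
          LinearMap.transvection (innerSL ℝ (‖y‖⁻¹ • y) : E →ₗ[ℝ] ℝ)
            (-((1 + ((1 - ‖x‖ ^ 2) / ‖‖y‖⁻¹ • y - x‖ ^ 2)⁻¹) • (‖y‖⁻¹ • y)))) := by
  have hζ := norm_inv_smul_self hy
  have h := sub_ne_zero_of_norm hx hζ
  have h1 : 1 - ‖x‖ ^ 2 ≠ 0 := by nlinarith [norm_nonneg x]
  have hy' := norm_ne_zero_iff.2 hy
  have hl : (1 - ‖x‖ ^ 2) / ‖‖y‖⁻¹ • y - x‖ ^ 2 ≠ 0 := by positivity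
  have hr := reflection_sub_apply hx hζ
  have hyζ : y = ‖y‖ • (‖y‖⁻¹ • y) := (smul_inv_smul₀ hy' y).symm
  simp only [coneMoebiusDeriv]
  ext1 v
  set l := (1 - ‖x‖ ^ 2) / ‖‖y‖⁻¹ • y - x‖ ^ 2
  clear_value l
  set ζ := ‖y‖⁻¹ • y with hζy
  set R := (ℝ ∙ (ζ - x))ᗮ.reflection
  have hs : sphereMoebius x ζ = - R ζ := by rw [hr, neg_neg]
  rw [hs]
  have hRy : R y = ‖y‖ • R ζ := by rw [← map_smul, ← hyζ]
  have hin : inner ℝ y v = ‖y‖ * inner ℝ ζ v := by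
    rw [hζy, real_inner_smul_left, mul_inv_cancel_left₀ hy']
  simp [LinearMap.transvection.apply, hRy, hin]
  match_scalars <;> field_simp
  ring

theorem abs_det_coneMoebiusDeriv [FiniteDimensional ℝ E] {x y : E} (hx : ‖x‖ < 1) (hy : y ≠ 0)
    (hE : 0 < finrank ℝ E) :
    |(coneMoebiusDeriv x y).det| =
      ((1 - ‖x‖ ^ 2) / ‖‖y‖⁻¹ • y - x‖ ^ 2) ^ (finrank ℝ E - 1) := by
  have hζ := norm_inv_smul_self hy
  have h := sub_ne_zero_of_norm hx hζ
  have h1 : 0 < 1 - ‖x‖ ^ 2 := by nlinarith [norm_nonneg x]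
  have hl : 0 < (1 - ‖x‖ ^ 2) / ‖‖y‖⁻¹ • y - x‖ ^ 2 := by positivity
  rw [ContinuousLinearMap.det, coneMoebiusDeriv_eq hx hy, LinearMap.det_comp, LinearMap.det_smul,
    LinearMap.transvection.det, abs_mul]
  have hR : |LinearMap.det
      ((ℝ ∙ (‖y‖⁻¹ • y - x))ᗮ.reflection.toLinearEquiv : E →ₗ[ℝ] E)| = 1 := by
    exact (congrArg abs (Submodule.det_reflection _)).trans (by simp)
  rw [hR, one_mul]
  obtain ⟨m, hm⟩ : ∃ m, finrank ℝ E = m + 1 := ⟨_, (Nat.succ_pred_eq_of_pos hE).symm⟩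
  rw [hm, Nat.add_sub_cancel, pow_succ]
  set l := (1 - ‖x‖ ^ 2) / ‖‖y‖⁻¹ • y - x‖ ^ 2
  rw [map_neg, map_smul, ContinuousLinearMap.coe_coe, innerSL_apply_apply,
    real_inner_self_eq_norm_sq, hζ]
  have : l ^ m * l * (1 + -((1 + l⁻¹) • (1 : ℝ) ^ 2)) = - l ^ m := by
    simp; field_simp
  rw [this, abs_neg, abs_of_nonneg (by positivity)]

end Moebius

theorem integral_comp_sphereMoebius {n : ℕ} [NeZero n] {x : EuclideanSpace ℝ (Fin n)}
    (hx : ‖x‖ < 1) (g : EuclideanSpace ℝ (Fin n) → ℝ) :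
    ∫ ζ, poissonKernel x (ζ : EuclideanSpace ℝ (Fin n)) * g (sphereMoebius x ζ) ∂(sphereMeasure n)
      = ∫ ζ, g ζ ∂(sphereMeasure n) := by
  obtain ⟨c, hc⟩ := exists_integral_sphereMeasure n
  rw [hc g, hc fun ζ ↦ poissonKernel x ζ * g (sphereMoebius x ζ)]
  congr 1
  have hs : MeasurableSet (ball (0 : EuclideanSpace ℝ (Fin n)) 1 \ {0}) :=
    measurableSet_ball.diff (measurableSet_singleton _)
  have h := integral_image_eq_integral_abs_det_fderiv_smul volume hs
    (fun y hy ↦ (hasFDerivAt_coneMoebius hx hy.2).hasFDerivWithinAt)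
    (LeftInvOn.injOn (f₁' := coneMoebius (-x)) fun y hy ↦ coneMoebius_neg_coneMoebius hx hy.2)
    (fun y ↦ g (‖y‖⁻¹ • y))
  rw [coneMoebius_image hx] at h
  rw [h]
  refine setIntegral_congr_fun hs fun y hy ↦ ?_
  beta_reduce
  rw [inv_norm_smul_coneMoebius hx hy.2, abs_det_coneMoebiusDeriv hx hy.2
    (by simpa using Nat.pos_of_neZero n), poissonKernel, norm_sub_rev, smul_eq_mul,
    finrank_euclideanSpace_fin]

section Duality

variable {α : Type*} [MeasurableSpace α] {μ : Measure α} [IsProbabilityMeasure μ]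

/-- The real exponent conjugate to `p`. -/
noncomputable def conjExp (p : ℝ≥0∞) : ℝ := (1 - p.toReal⁻¹)⁻¹

theorem conjExp_top : conjExp ∞ = 1 := by simp [conjExp]

theorem one_lt_toReal {p : ℝ≥0∞} (hp : 1 < p) (hp' : p ≠ ∞) : 1 < p.toReal := by
  simpa using (ENNReal.toReal_lt_toReal ENNReal.one_ne_top hp').2 hp

theorem holderConjugate_conjExp {p : ℝ≥0∞} (hp : 1 < p) (hp' : p ≠ ∞) :
    (conjExp p).HolderConjugate p.toReal := by
  have h := one_lt_toReal hp hp'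
  have h1 : p.toReal⁻¹ < 1 := inv_lt_one_of_one_lt₀ h
  have h2 : 0 < p.toReal⁻¹ := by positivity
  rw [Real.holderConjugate_iff, conjExp, inv_inv]
  exact ⟨(one_lt_inv₀ (by linarith)).2 (by linarith), by ring⟩

theorem one_le_conjExp {p : ℝ≥0∞} (hp : 1 < p) : 1 ≤ conjExp p := by
  by_cases hp' : p = ∞
  · rw [hp', conjExp_top]
  · exact (holderConjugate_conjExp hp hp').lt.le

theorem integrable_rpow_abs {K : α → ℝ} (hK : Measurable K) {M : ℝ} (hM : ∀ a, |K a| ≤ M) {q : ℝ}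
    (hq : 0 ≤ q) : Integrable (fun a ↦ |K a| ^ q) μ := by
  refine Integrable.of_bound (C := M ^ q) (by fun_prop) (.of_forall fun a ↦ ?_)
  rw [Real.norm_of_nonneg (by positivity)]
  exact Real.rpow_le_rpow (abs_nonneg _) (hM a) hq

theorem abs_integral_mul_le {K : α → ℝ} (hK : Measurable K) {M : ℝ} (hM : ∀ a, |K a| ≤ M)
    {p : ℝ≥0∞} (hp : 1 < p) {φ : α → ℝ} (hφ : MemLp φ p μ) :
    |∫ a, K a * φ a ∂μ| ≤
      (∫ a, |K a| ^ conjExp p ∂μ) ^ (1 / conjExp p) * (eLpNorm φ p μ).toReal := by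
  have h0 : |∫ a, K a * φ a ∂μ| ≤ ∫ a, ‖K a‖ * ‖φ a‖ ∂μ := by
    simpa only [Real.norm_eq_abs, abs_mul] using
      norm_integral_le_integral_norm (μ := μ) (fun a ↦ K a * φ a)
  refine h0.trans ?_
  by_cases hp' : p = ∞
  · subst hp'
    simp only [conjExp_top, Real.rpow_one, div_one]
    rw [← integral_mul_const]
    have hKi : Integrable (fun a ↦ |K a|) μ := by
      simpa using integrable_rpow_abs (μ := μ) hK hM zero_le_one
    refine integral_mono_of_nonneg (.of_forall fun a ↦ by positivity) (hKi.mul_const _) ?_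
    filter_upwards [ae_le_eLpNormEssSup (f := φ) (μ := μ)] with a ha
    refine mul_le_mul_of_nonneg_left ?_ (abs_nonneg _)
    have h := ENNReal.toReal_mono hφ.2.ne (by simpa using ha)
    simpa using h
  · have hc := holderConjugate_conjExp hp hp'
    have hpp : ENNReal.ofReal p.toReal = p := ENNReal.ofReal_toReal hp'
    have h := integral_mul_norm_le_Lp_mul_Lq (μ := μ) hc (f := K) (g := φ)
      (MemLp.of_bound hK.aestronglyMeasurable M (.of_forall hM)) (by rwa [hpp])
    rw [hφ.eLpNorm_eq_integral_rpow_norm (by positivity) hp', ENNReal.toReal_ofReal (by positivity)]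
    simpa using h

/-- Duality of `L^p` and `L^q`: the operator norm of integration against `K`. -/
theorem isLeast_dual {K : α → ℝ} (hK : Measurable K) {M : ℝ} (hM : ∀ a, |K a| ≤ M)
    {p : ℝ≥0∞} (hp : 1 < p) :
    IsLeast {C : ℝ | ∀ φ : α → ℝ, MemLp φ p μ →
        |∫ a, K a * φ a ∂μ| ≤ C * (eLpNorm φ p μ).toReal}
      ((∫ a, |K a| ^ conjExp p ∂μ) ^ (1 / conjExp p)) := by
  refine ⟨fun φ hφ ↦ abs_integral_mul_le hK hM hp hφ, fun C hC ↦ ?_⟩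
  have hq1 := one_le_conjExp hp
  have hq0 : 0 < conjExp p := by linarith
  have hC0 : 0 ≤ C := by
    have h := hC (fun _ ↦ 1) (memLp_const 1)
    rw [eLpNorm_const _ (by positivity) (IsProbabilityMeasure.ne_zero μ)] at h
    simp only [measure_univ, ENNReal.one_rpow, mul_one, enorm_one, ENNReal.toReal_one] at h
    exact (abs_nonneg _).trans h
  set A := ∫ a, |K a| ^ conjExp p ∂μ
  have hA : 0 ≤ A := integral_nonneg fun a ↦ by positivity
  rcases hA.eq_or_lt with hA0 | hApos
  · rw [← hA0, Real.zero_rpow (by positivity)]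
    exact hC0
  set φ : α → ℝ := fun a ↦ SignType.sign (K a) * |K a| ^ (conjExp p - 1)
  have hsign : Measurable fun a ↦ ((SignType.sign (K a) : SignType) : ℝ) := by
    have : (fun a ↦ ((SignType.sign (K a) : SignType) : ℝ)) =
        fun a ↦ if 0 < K a then 1 else if K a < 0 then -1 else 0 := by
      ext a
      rw [sign_apply]
      split_ifs <;> simp
    rw [this]
    exact Measurable.ite (measurableSet_lt measurable_const hK) measurable_const
      (Measurable.ite (measurableSet_lt hK measurable_const) measurable_const measurable_const)
  have hφabs : ∀ a, |φ a| ≤ |K a| ^ (conjExp p - 1) := by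
    intro a
    rw [abs_mul, abs_of_nonneg (by positivity : 0 ≤ |K a| ^ (conjExp p - 1))]
    refine mul_le_of_le_one_left (by positivity) ?_
    rcases lt_trichotomy (K a) 0 with h | h | h <;> simp [h]
  have hφ : MemLp φ p μ := by
    refine MemLp.of_bound (C := M ^ (conjExp p - 1))
      (hsign.mul (by fun_prop)).aestronglyMeasurable (.of_forall fun a ↦ (hφabs a).trans ?_)
    exact Real.rpow_le_rpow (abs_nonneg _) (hM a) (by linarith)
  have hint : ∫ a, K a * φ a ∂μ = A := by
    refine integral_congr_ae (.of_forall fun a ↦ ?_)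
    by_cases h : K a = 0
    · simp [h, Real.zero_rpow hq0.ne']
    · have h1 : K a * φ a = |K a| * |K a| ^ (conjExp p - 1) := by
        simp only [φ]
        rw [← mul_assoc, self_mul_sign]
      simp only [h1]
      rw [← Real.rpow_one_add' (abs_nonneg _) (by linarith), add_sub_cancel]
  have h := hC φ hφ
  rw [hint, abs_of_nonneg hA] at h
  by_cases hp' : p = ∞
  · subst hp'
    simp only [conjExp_top, div_one, Real.rpow_one]
    refine h.trans (mul_le_of_le_one_right hC0 ?_)
    have h1 : eLpNorm φ ∞ μ ≤ 1 := by
      rw [eLpNorm_exponent_top]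
      refine eLpNormEssSup_le_of_ae_enorm_bound (.of_forall fun a ↦ ?_)
      have := hφabs a
      rw [conjExp_top, sub_self, Real.rpow_zero] at this
      rw [← ofReal_norm, Real.norm_eq_abs]
      exact ENNReal.ofReal_le_one.2 this
    simpa using ENNReal.toReal_mono ENNReal.one_ne_top h1
  · have hc := holderConjugate_conjExp hp hp'
    have hnorm : (eLpNorm φ p μ).toReal = A ^ (p.toReal⁻¹) := by
      rw [hφ.eLpNorm_eq_integral_rpow_norm (by positivity) hp',
        ENNReal.toReal_ofReal (by positivity)]
      congr 1
      refine integral_congr_ae (.of_forall fun a ↦ ?_)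
      by_cases h : K a = 0
      · simp [φ, h, Real.zero_rpow hq0.ne', Real.zero_rpow hc.symm.ne_zero]
      · have h2 : |φ a| = |K a| ^ (conjExp p - 1) := by
          simp only [φ]
          rw [abs_mul, abs_of_nonneg (by positivity : 0 ≤ |K a| ^ (conjExp p - 1))]
          rcases lt_or_gt_of_ne h with h' | h' <;> simp [h']
        simp only [Real.norm_eq_abs, h2]
        rw [← Real.rpow_mul (abs_nonneg _), hc.sub_one_mul_conj]
    rw [hnorm] at h
    have h3 : 1 / conjExp p = 1 - p.toReal⁻¹ := by rw [conjExp, one_div, inv_inv]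
    rw [h3, Real.rpow_sub hApos, Real.rpow_one]
    exact (div_le_iff₀ (by positivity)).2 h

end Duality

section Gradient

variable {n : ℕ}

/-- The gradient in `x` of the Poisson kernel `P_h(x, ζ)`. -/
noncomputable def kernelGrad (x ζ : EuclideanSpace ℝ (Fin n)) : EuclideanSpace ℝ (Fin n) :=
  (2 * (n - 1 : ℕ) / (1 - ‖x‖ ^ 2) * poissonKernel x ζ) • sphereMoebius x ζ

theorem poissonKernel_nonneg {x : EuclideanSpace ℝ (Fin n)} (hx : ‖x‖ < 1)
    (ζ : EuclideanSpace ℝ (Fin n)) : 0 ≤ poissonKernel x ζ := by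
  have : 0 ≤ 1 - ‖x‖ ^ 2 := by nlinarith [norm_nonneg x]
  unfold poissonKernel
  positivity

theorem hasFDerivAt_poissonKernel {x ζ : EuclideanSpace ℝ (Fin n)} (hx : ‖x‖ < 1) (hζ : ‖ζ‖ = 1) :
    HasFDerivAt (fun y ↦ poissonKernel y ζ) (innerSL ℝ (kernelGrad x ζ)) x := by
  have h := sub_ne_zero_of_norm hx hζ
  have h1 : 1 - ‖x‖ ^ 2 ≠ 0 := by nlinarith [norm_nonneg x]
  have hnum := ((hasFDerivAt_id (𝕜 := ℝ) x).norm_sq).const_sub 1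
  have hden := ((hasFDerivAt_id (𝕜 := ℝ) x).sub_const ζ).norm_sq
  have h' : ‖x - ζ‖ ≠ 0 := by rwa [norm_sub_rev]
  have hd := ((hnum.mul ((hasDerivAt_inv (pow_ne_zero 2 h')).comp_hasFDerivAt x hden))).pow (n - 1)
  refine (hd.congr_of_eventuallyEq (.of_forall fun y ↦ ?_)).congr_fderiv ?_
  · simp [poissonKernel, div_eq_mul_inv]
  · ext v
    rw [kernelGrad, poissonKernel, norm_sub_rev x ζ, sphereMoebius]
    cases n - 1 with
    | zero => simp
    | succ m =>
      simp [norm_sub_rev x ζ, div_eq_mul_inv]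
      rw [pow_succ _ m]
      generalize ((1 - ‖x‖ ^ 2) * (‖ζ - x‖ ^ 2)⁻¹) ^ m = B
      field_simp
      ring

theorem norm_kernelGrad {x ζ : EuclideanSpace ℝ (Fin n)} (hx : ‖x‖ < 1) (hζ : ‖ζ‖ = 1) :
    ‖kernelGrad x ζ‖ = 2 * (n - 1 : ℕ) / (1 - ‖x‖ ^ 2) * poissonKernel x ζ := by
  have h1 : 0 ≤ 1 - ‖x‖ ^ 2 := by nlinarith [norm_nonneg x]
  have := poissonKernel_nonneg hx ζ
  rw [kernelGrad, norm_smul, norm_sphereMoebius hx hζ, mul_one, Real.norm_of_nonneg (by positivity)]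

theorem poissonKernel_le {x ζ : EuclideanSpace ℝ (Fin n)} {ρ : ℝ} (hρ : ρ < 1) (hx : ‖x‖ ≤ ρ)
    (hζ : ‖ζ‖ = 1) : poissonKernel x ζ ≤ (1 / (1 - ρ) ^ 2) ^ (n - 1) := by
  have h1 : 0 ≤ 1 - ‖x‖ ^ 2 := by nlinarith [norm_nonneg x]
  have h2 : 1 - ρ ≤ ‖x - ζ‖ := by
    have := norm_sub_norm_le ζ x
    rw [norm_sub_rev] at this
    linarith
  have h3 : 0 < 1 - ρ := by linarith
  unfold poissonKernel
  gcongr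
  nlinarith [norm_nonneg x]

theorem norm_kernelGrad_le {x ζ : EuclideanSpace ℝ (Fin n)} {ρ : ℝ} (hρ : ρ < 1) (hx : ‖x‖ ≤ ρ)
    (hζ : ‖ζ‖ = 1) :
    ‖kernelGrad x ζ‖ ≤ 2 * (n - 1 : ℕ) / (1 - ρ ^ 2) * (1 / (1 - ρ) ^ 2) ^ (n - 1) := by
  have h0 := norm_nonneg x
  rw [norm_kernelGrad (by linarith) hζ]
  have h1 : 0 < 1 - ρ ^ 2 := by nlinarith
  have h2 := poissonKernel_le hρ hx hζ
  have h3 := poissonKernel_nonneg (hx.trans_lt hρ) ζ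
  gcongr

theorem continuous_sphereMoebius {x : EuclideanSpace ℝ (Fin n)} (hx : ‖x‖ < 1) :
    Continuous fun ζ : sphere (0 : EuclideanSpace ℝ (Fin n)) 1 ↦
      sphereMoebius x (ζ : EuclideanSpace ℝ (Fin n)) := by
  unfold sphereMoebius
  have : ∀ ζ : sphere (0 : EuclideanSpace ℝ (Fin n)) 1, ‖(ζ : EuclideanSpace ℝ (Fin n)) - x‖ ^ 2 ≠ 0 :=
    fun ζ ↦ pow_ne_zero _ (sub_ne_zero_of_norm hx (by simp))
  fun_prop (disch := assumption)

theorem continuous_poissonKernel {x : EuclideanSpace ℝ (Fin n)} (hx : ‖x‖ < 1) :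
    Continuous fun ζ : sphere (0 : EuclideanSpace ℝ (Fin n)) 1 ↦
      poissonKernel x (ζ : EuclideanSpace ℝ (Fin n)) := by
  unfold poissonKernel
  have : ∀ ζ : sphere (0 : EuclideanSpace ℝ (Fin n)) 1, ‖x - (ζ : EuclideanSpace ℝ (Fin n))‖ ^ 2 ≠ 0 :=
    fun ζ ↦ pow_ne_zero _ (by rw [norm_sub_rev]; exact sub_ne_zero_of_norm hx (by simp))
  fun_prop (disch := assumption)

theorem continuous_kernelGrad {x : EuclideanSpace ℝ (Fin n)} (hx : ‖x‖ < 1) :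
    Continuous fun ζ : sphere (0 : EuclideanSpace ℝ (Fin n)) 1 ↦
      kernelGrad x (ζ : EuclideanSpace ℝ (Fin n)) :=
  (continuous_const.mul (continuous_poissonKernel hx)).smul (continuous_sphereMoebius hx)

theorem integrable_smul_kernelGrad {x : EuclideanSpace ℝ (Fin n)} (hx : ‖x‖ < 1)
    {φ : sphere (0 : EuclideanSpace ℝ (Fin n)) 1 → ℝ} (hφ : Integrable φ (sphereMeasure n)) :
    Integrable (fun ζ ↦ φ ζ • innerSL ℝ (kernelGrad x (ζ : EuclideanSpace ℝ (Fin n))))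
      (sphereMeasure n) := by
  refine hφ.smul_bdd (2 * (n - 1 : ℕ) / (1 - ‖x‖ ^ 2) * (1 / (1 - ‖x‖) ^ 2) ^ (n - 1))
    ((innerSL ℝ).continuous.comp (continuous_kernelGrad hx)).aestronglyMeasurable
    (.of_forall fun ζ ↦ ?_)
  rw [innerSL_apply_norm]
  exact norm_kernelGrad_le hx le_rfl (by simp)

theorem hasFDerivAt_poissonIntegral {x : EuclideanSpace ℝ (Fin n)} (hx : ‖x‖ < 1)
    {φ : sphere (0 : EuclideanSpace ℝ (Fin n)) 1 → ℝ} (hφ : Integrable φ (sphereMeasure n)) :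
    HasFDerivAt (poissonIntegral φ)
      (∫ ζ, φ ζ • innerSL ℝ (kernelGrad x (ζ : EuclideanSpace ℝ (Fin n))) ∂(sphereMeasure n)) x := by
  set ρ := (1 + ‖x‖) / 2
  have hρ : ρ < 1 := by simp only [ρ]; linarith
  have hxρ : ‖x‖ < ρ := by simp only [ρ]; linarith
  have hs : ball (0 : EuclideanSpace ℝ (Fin n)) ρ ∈ nhds x := isOpen_ball.mem_nhds (by simpa)
  set M := 2 * (n - 1 : ℕ) / (1 - ρ ^ 2) * (1 / (1 - ρ) ^ 2) ^ (n - 1)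
  refine hasFDerivAt_integral_of_dominated_of_fderiv_le (𝕜 := ℝ)
    (F := fun y (ζ : sphere (0 : EuclideanSpace ℝ (Fin n)) 1) ↦ poissonKernel y (ζ : EuclideanSpace ℝ (Fin n)) * φ ζ)
    (F' := fun y (ζ : sphere (0 : EuclideanSpace ℝ (Fin n)) 1) ↦ φ ζ • innerSL ℝ (kernelGrad y (ζ : EuclideanSpace ℝ (Fin n))))
    (bound := fun ζ ↦ ‖φ ζ‖ * M) hs ?_ ?_ (integrable_smul_kernelGrad hx hφ).aestronglyMeasurable
    (.of_forall fun ζ y hy ↦ ?_) (hφ.norm.mul_const M) (.of_forall fun ζ y hy ↦ ?_)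
  · filter_upwards [hs] with y hy
    have hy' : ‖y‖ < 1 := (by simpa using hy : ‖y‖ < ρ).trans hρ
    exact (continuous_poissonKernel hy').aestronglyMeasurable.mul hφ.aestronglyMeasurable
  · refine hφ.bdd_mul (c := (1 / (1 - ‖x‖) ^ 2) ^ (n - 1))
      (continuous_poissonKernel hx).aestronglyMeasurable (.of_forall fun ζ ↦ ?_)
    rw [Real.norm_of_nonneg (poissonKernel_nonneg hx _)]
    exact poissonKernel_le hx le_rfl (by simp)
  · have hy' : ‖y‖ < ρ := by simpa using hy
    rw [norm_smul, innerSL_apply_norm]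
    exact mul_le_mul_of_nonneg_left (norm_kernelGrad_le hρ hy'.le (by simp)) (norm_nonneg _)
  · have hy' : ‖y‖ < ρ := by simpa using hy
    exact (hasFDerivAt_poissonKernel (hy'.trans hρ) (by simp)).mul_const (φ ζ)

theorem inner_gradient_poissonIntegral {x : EuclideanSpace ℝ (Fin n)} (hx : ‖x‖ < 1)
    {φ : sphere (0 : EuclideanSpace ℝ (Fin n)) 1 → ℝ} (hφ : Integrable φ (sphereMeasure n))
    (ℓ : EuclideanSpace ℝ (Fin n)) :
    inner ℝ (gradient (poissonIntegral φ) x) ℓ =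
      ∫ ζ, inner ℝ (kernelGrad x (ζ : EuclideanSpace ℝ (Fin n))) ℓ * φ ζ ∂(sphereMeasure n) := by
  rw [gradient, InnerProductSpace.toDual_symm_apply, (hasFDerivAt_poissonIntegral hx hφ).fderiv,
    ContinuousLinearMap.integral_apply (integrable_smul_kernelGrad hx hφ)]
  simp [mul_comm]

/-- The `q`-th power of the optimal directional constant, up to a factor independent of `ℓ`,
after the conformal change of variables. -/
noncomputable def sphereFunctional (q α : ℝ) (x ℓ : EuclideanSpace ℝ (Fin n)) : ℝ :=
  ∫ η, |inner ℝ (η : EuclideanSpace ℝ (Fin n)) ℓ| ^ q *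
    (‖(η : EuclideanSpace ℝ (Fin n)) + x‖ ^ 2) ^ α ∂(sphereMeasure n)

theorem integral_rpow_kernelGrad [NeZero n] {x : EuclideanSpace ℝ (Fin n)} (hx : ‖x‖ < 1)
    {q : ℝ} (hq : 1 ≤ q) (ℓ : EuclideanSpace ℝ (Fin n)) :
    ∫ ζ, |inner ℝ (kernelGrad x (ζ : EuclideanSpace ℝ (Fin n))) ℓ| ^ q ∂(sphereMeasure n) =
      ((2 * (n - 1 : ℕ) / (1 - ‖x‖ ^ 2)) ^ q * ((1 - ‖x‖ ^ 2)⁻¹) ^ ((n - 1 : ℕ) * (q - 1))) *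
        sphereFunctional q ((n - 1 : ℕ) * (q - 1)) x ℓ := by
  have h1 : 0 < 1 - ‖x‖ ^ 2 := by nlinarith [norm_nonneg x]
  rw [sphereFunctional, ← integral_comp_sphereMoebius hx
    (fun η ↦ |inner ℝ η ℓ| ^ q * (‖η + x‖ ^ 2) ^ (((n - 1 : ℕ) : ℝ) * (q - 1))),
    ← integral_const_mul]
  refine integral_congr_ae (.of_forall fun ζ ↦ ?_)
  have hζ : ‖(ζ : EuclideanSpace ℝ (Fin n))‖ = 1 := by simp
  set z := (ζ : EuclideanSpace ℝ (Fin n))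
  have hP := poissonKernel_nonneg hx z
  have hz : 0 < ‖z - x‖ := (norm_nonneg _).lt_of_ne' (sub_ne_zero_of_norm hx hζ)
  have hPeq : poissonKernel x z = ((1 - ‖x‖ ^ 2)⁻¹ * ‖sphereMoebius x z + x‖ ^ 2) ^ (n - 1) := by
    rw [poissonKernel, norm_sphereMoebius_add_sq hx hζ, norm_sub_rev]
    congr 1
    field_simp
  have hPq : poissonKernel x z ^ q = poissonKernel x z *
      (((1 - ‖x‖ ^ 2)⁻¹) ^ (((n - 1 : ℕ) : ℝ) * (q - 1)) *
        (‖sphereMoebius x z + x‖ ^ 2) ^ (((n - 1 : ℕ) : ℝ) * (q - 1))) := by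
    rw [← Real.mul_rpow (by positivity) (by positivity), Real.rpow_mul (by positivity),
      Real.rpow_natCast, ← hPeq, ← Real.rpow_one_add' hP (by linarith), add_sub_cancel]
  simp only [kernelGrad, real_inner_smul_left]
  rw [abs_mul, abs_of_nonneg (by positivity), Real.mul_rpow (by positivity) (by positivity),
    Real.mul_rpow (by positivity) hP, hPq]
  ring

theorem isLeast_dirBounds [NeZero n] {x : EuclideanSpace ℝ (Fin n)} (hx : ‖x‖ < 1)
    {p : ℝ≥0∞} (hp : 1 < p) (ℓ : EuclideanSpace ℝ (Fin n)) :
    IsLeast (dirBounds p x ℓ)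
      ((∫ ζ, |inner ℝ (kernelGrad x (ζ : EuclideanSpace ℝ (Fin n))) ℓ| ^ conjExp p
        ∂(sphereMeasure n)) ^ (1 / conjExp p)) := by
  have hK : Continuous fun ζ : sphere (0 : EuclideanSpace ℝ (Fin n)) 1 ↦
      inner ℝ (kernelGrad x (ζ : EuclideanSpace ℝ (Fin n))) ℓ :=
    (continuous_kernelGrad hx).inner continuous_const
  convert isLeast_dual (μ := sphereMeasure n) hK.measurable
    (M := 2 * (n - 1 : ℕ) / (1 - ‖x‖ ^ 2) * (1 / (1 - ‖x‖) ^ 2) ^ (n - 1) * ‖ℓ‖) ?_ hp using 1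
  · ext C
    refine forall_congr' fun φ ↦ forall_congr' fun hφ ↦ ?_
    rw [inner_gradient_poissonIntegral hx (hφ.integrable hp.le)]
  · intro ζ
    refine (abs_real_inner_le_norm _ _).trans ?_
    exact mul_le_mul_of_nonneg_right (norm_kernelGrad_le hx le_rfl (by simp)) (norm_nonneg _)

theorem isLeast_dirConst [NeZero n] {x : EuclideanSpace ℝ (Fin n)} (hx : ‖x‖ < 1)
    {p : ℝ≥0∞} (hp : 1 < p) (ℓ : EuclideanSpace ℝ (Fin n)) :
    IsLeast (dirBounds p x ℓ) (dirConst p x ℓ) := by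
  have h := isLeast_dirBounds hx hp ℓ
  rwa [dirConst, h.csInf_eq]

theorem sphereFunctional_nonneg (q α : ℝ) (x ℓ : EuclideanSpace ℝ (Fin n)) :
    0 ≤ sphereFunctional q α x ℓ :=
  integral_nonneg fun η ↦ by positivity

theorem dirConst_le_dirConst [NeZero n] {x : EuclideanSpace ℝ (Fin n)} (hx : ‖x‖ < 1)
    {p : ℝ≥0∞} (hp : 1 < p) {ℓ ℓ' : EuclideanSpace ℝ (Fin n)}
    (h : sphereFunctional (conjExp p) ((n - 1 : ℕ) * (conjExp p - 1)) x ℓ ≤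
      sphereFunctional (conjExp p) ((n - 1 : ℕ) * (conjExp p - 1)) x ℓ') :
    dirConst p x ℓ ≤ dirConst p x ℓ' := by
  have h1 : 0 < 1 - ‖x‖ ^ 2 := by nlinarith [norm_nonneg x]
  have hq := one_le_conjExp hp
  have := sphereFunctional_nonneg (conjExp p) ((n - 1 : ℕ) * (conjExp p - 1)) x ℓ
  rw [dirConst, dirConst, (isLeast_dirBounds hx hp ℓ).csInf_eq,
    (isLeast_dirBounds hx hp ℓ').csInf_eq, integral_rpow_kernelGrad hx hq,
    integral_rpow_kernelGrad hx hq]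
  gcongr

end Gradient

section Comparison

variable {n : ℕ}

theorem integrable_abs_inner_rpow_mul [NeZero n] {q : ℝ} (hq : 0 ≤ q) {w : ℝ → ℝ}
    (hw : Continuous w) (x ℓ : EuclideanSpace ℝ (Fin n)) :
    Integrable (fun η : sphere (0 : EuclideanSpace ℝ (Fin n)) 1 ↦
      |inner ℝ (η : EuclideanSpace ℝ (Fin n)) ℓ| ^ q * w (inner ℝ (η : EuclideanSpace ℝ (Fin n)) x))
      (sphereMeasure n) := by
  have hc : Continuous fun η : sphere (0 : EuclideanSpace ℝ (Fin n)) 1 ↦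
      |inner ℝ (η : EuclideanSpace ℝ (Fin n)) ℓ| ^ q *
        w (inner ℝ (η : EuclideanSpace ℝ (Fin n)) x) := by
    refine Continuous.mul (Continuous.rpow_const (by fun_prop) fun _ ↦ Or.inr hq) ?_
    fun_prop
  exact hc.integrable_of_hasCompactSupport (HasCompactSupport.of_compactSpace _)

theorem inner_reflection_comm {E : Type*} [NormedAddCommGroup E] [InnerProductSpace ℝ E]
    (K : Submodule ℝ E) [K.HasOrthogonalProjection] (u v : E) :
    inner ℝ (K.reflection u) v = inner ℝ u (K.reflection v) := by
  rw [← K.reflection.inner_map_map u, K.reflection_reflection]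

/-- Chebyshev's inequality for a pair of directions exchanged by a reflection. -/
theorem integral_abs_inner_rpow_mul_le [NeZero n] {q : ℝ} (hq : 0 ≤ q) {w : ℝ → ℝ}
    (hw : Continuous w) {x ℓ ℓ' : EuclideanSpace ℝ (Fin n)}
    (hmono : ∀ s t, |s| ≤ |t| → |t| ≤ ‖x‖ → w s ≤ w t) (hℓ : ‖ℓ‖ = ‖ℓ'‖) {c : ℝ} (hc : 0 ≤ c)
    (h : ∀ η, inner ℝ η x ^ 2 - inner ℝ η ((ℝ ∙ (ℓ - ℓ'))ᗮ.reflection x) ^ 2 =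
      c * (inner ℝ η ℓ ^ 2 - inner ℝ η ℓ' ^ 2)) :
    ∫ η, |inner ℝ (η : EuclideanSpace ℝ (Fin n)) ℓ'| ^ q *
        w (inner ℝ (η : EuclideanSpace ℝ (Fin n)) x) ∂(sphereMeasure n) ≤
      ∫ η, |inner ℝ (η : EuclideanSpace ℝ (Fin n)) ℓ| ^ q *
        w (inner ℝ (η : EuclideanSpace ℝ (Fin n)) x) ∂(sphereMeasure n) := by
  set R := (ℝ ∙ (ℓ - ℓ'))ᗮ.reflection
  have hR : R ℓ = ℓ' := Submodule.reflection_sub hℓ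
  have hR' : R ℓ' = ℓ := by rw [← hR]; exact Submodule.reflection_reflection _ _
  have hsymm : ∀ u v, inner ℝ (R u) v = inner ℝ u (R v) := inner_reflection_comm _
  have e1 := integral_sphereMeasure_comp_isometry R
    (fun η ↦ |inner ℝ η ℓ| ^ q * w (inner ℝ η x))
  have e2 := integral_sphereMeasure_comp_isometry R
    (fun η ↦ |inner ℝ η ℓ'| ^ q * w (inner ℝ η x))
  simp only [hsymm, hR, hR'] at e1 e2
  have i1 := integrable_abs_inner_rpow_mul hq hw x ℓ
  have i2 := integrable_abs_inner_rpow_mul hq hw x ℓ'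
  have i3 := integrable_abs_inner_rpow_mul hq hw (R x) ℓ
  have i4 := integrable_abs_inner_rpow_mul hq hw (R x) ℓ'
  have key := integral_mono (μ := sphereMeasure n) (i2.add i3) (i1.add i4) fun η ↦ by
    have hη : ‖(η : EuclideanSpace ℝ (Fin n))‖ = 1 := by simp
    have hx : |inner ℝ (η : EuclideanSpace ℝ (Fin n)) x| ≤ ‖x‖ := by
      simpa [hη] using abs_real_inner_le_norm (η : EuclideanSpace ℝ (Fin n)) x
    have hRx : |inner ℝ (η : EuclideanSpace ℝ (Fin n)) (R x)| ≤ ‖x‖ := by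
      simpa [hη] using abs_real_inner_le_norm (η : EuclideanSpace ℝ (Fin n)) (R x)
    have hη' := h η
    simp only [Pi.add_apply]
    rcases le_total |inner ℝ (η : EuclideanSpace ℝ (Fin n)) ℓ'|
      |inner ℝ (η : EuclideanSpace ℝ (Fin n)) ℓ| with hle | hle
    · have h1 := Real.rpow_le_rpow (abs_nonneg _) hle hq
      have h3 := mul_nonneg hc (sub_nonneg.2 (sq_le_sq.2 hle))
      rw [← hη', sub_nonneg] at h3
      have h2 := hmono _ _ (sq_le_sq.1 h3) hx
      nlinarith
    · have h1 := Real.rpow_le_rpow (abs_nonneg _) hle hq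
      have h3 := mul_nonneg hc (sub_nonneg.2 (sq_le_sq.2 hle))
      rw [← neg_sub, mul_neg, ← hη', neg_sub, sub_nonneg] at h3
      have h2 := hmono _ _ (sq_le_sq.1 h3) hRx
      nlinarith
  simp only [Pi.add_apply] at key
  rw [integral_add i2 i3, integral_add i1 i4, e1, e2] at key
  linarith

theorem integral_abs_inner_rpow_mul_le_radial [NeZero n] {q : ℝ} (hq : 0 ≤ q) {w : ℝ → ℝ}
    (hw : Continuous w) {x : EuclideanSpace ℝ (Fin n)} (hx : x ≠ 0)
    (hmono : ∀ s t, |s| ≤ |t| → |t| ≤ ‖x‖ → w s ≤ w t)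
    {ℓ : EuclideanSpace ℝ (Fin n)} (hℓ : ‖ℓ‖ = 1) :
    ∫ η, |inner ℝ (η : EuclideanSpace ℝ (Fin n)) ℓ| ^ q *
        w (inner ℝ (η : EuclideanSpace ℝ (Fin n)) x) ∂(sphereMeasure n) ≤
      ∫ η, |inner ℝ (η : EuclideanSpace ℝ (Fin n)) (‖x‖⁻¹ • x)| ^ q *
        w (inner ℝ (η : EuclideanSpace ℝ (Fin n)) x) ∂(sphereMeasure n) := by
  have he : ‖‖x‖⁻¹ • x‖ = ‖ℓ‖ := by rw [norm_inv_smul_self hx, hℓ]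
  refine integral_abs_inner_rpow_mul_le hq hw hmono he (sq_nonneg ‖x‖) fun η ↦ ?_
  have hR : (ℝ ∙ (‖x‖⁻¹ • x - ℓ))ᗮ.reflection (‖x‖⁻¹ • x) = ℓ := Submodule.reflection_sub he
  have hx' := norm_ne_zero_iff.2 hx
  have hRx : (ℝ ∙ (‖x‖⁻¹ • x - ℓ))ᗮ.reflection x = ‖x‖ • ℓ := by
    conv_rhs => rw [← hR, map_smul, smul_inv_smul₀ hx']
  rw [hRx, inner_smul_right, inner_smul_right]
  field_simp

theorem integral_abs_inner_rpow_mul_le_of_orthogonal [NeZero n] {q : ℝ} (hq : 0 ≤ q) {w : ℝ → ℝ}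
    (hw : Continuous w) {x : EuclideanSpace ℝ (Fin n)}
    (hmono : ∀ s t, |s| ≤ |t| → |t| ≤ ‖x‖ → w s ≤ w t)
    {t t' : EuclideanSpace ℝ (Fin n)} (ht : ‖t‖ = 1) (ht' : ‖t'‖ = 1) (hxt : inner ℝ t x = 0)
    (hxt' : inner ℝ t' x = 0) :
    ∫ η, |inner ℝ (η : EuclideanSpace ℝ (Fin n)) t'| ^ q *
        w (inner ℝ (η : EuclideanSpace ℝ (Fin n)) x) ∂(sphereMeasure n) ≤
      ∫ η, |inner ℝ (η : EuclideanSpace ℝ (Fin n)) t| ^ q *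
        w (inner ℝ (η : EuclideanSpace ℝ (Fin n)) x) ∂(sphereMeasure n) := by
  refine integral_abs_inner_rpow_mul_le hq hw hmono (ht.trans ht'.symm) le_rfl fun η ↦ ?_
  have hRx : (ℝ ∙ (t - t'))ᗮ.reflection x = x := by
    refine Submodule.reflection_mem_subspace_eq_self ?_
    rw [Submodule.mem_orthogonal_singleton_iff_inner_right, inner_sub_left, hxt, hxt', sub_zero]
  rw [hRx]
  ring

/-- A unit vector not orthogonal to `x` lies in the plane of `x` and a unit vector orthogonal
to `x`. -/
theorem exists_orthogonal_decomposition {E : Type*} [NormedAddCommGroup E] [InnerProductSpace ℝ E]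
    {x t : E} (hx : x ≠ 0) (ht : ‖t‖ = 1) (hxt : inner ℝ t x = 0) (ℓ : E) :
    ∃ (t₀ : E) (a b : ℝ), ‖t₀‖ = 1 ∧ inner ℝ t₀ x = 0 ∧ ℓ = a • x + b • t₀ := by
  set a := inner ℝ ℓ x / ‖x‖ ^ 2
  have hx' := norm_ne_zero_iff.2 hx
  have hort : inner ℝ (ℓ - a • x) x = 0 := by
    rw [inner_sub_left, real_inner_smul_left, real_inner_self_eq_norm_sq]
    simp only [a]
    field_simp
    ring
  by_cases hv : ℓ - a • x = 0
  · exact ⟨t, a, 0, ht, hxt, by rw [zero_smul, add_zero, sub_eq_zero.1 hv]⟩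
  · refine ⟨‖ℓ - a • x‖⁻¹ • (ℓ - a • x), a, ‖ℓ - a • x‖, norm_inv_smul_self hv, ?_, ?_⟩
    · rw [real_inner_smul_left, hort, mul_zero]
    · rw [smul_inv_smul₀ (norm_ne_zero_iff.2 hv)]
      abel

theorem reflection_sub_apply_of_eq {E : Type*} [NormedAddCommGroup E] [InnerProductSpace ℝ E]
    {x t ℓ : E} {a b : ℝ} (he : ‖ℓ‖ = ‖t‖) (ha : a ≠ 0) (hnorm : a ^ 2 * ‖x‖ ^ 2 + b ^ 2 = 1)
    (hab : ℓ = a • x + b • t) :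
    (ℝ ∙ (ℓ - t))ᗮ.reflection x = (a * ‖x‖ ^ 2) • t - b • x := by
  have hR : (ℝ ∙ (ℓ - t))ᗮ.reflection ℓ = t := Submodule.reflection_sub he
  have hR' : (ℝ ∙ (ℓ - t))ᗮ.reflection t = ℓ := by
    conv_lhs => enter [2]; rw [← hR]
    exact Submodule.reflection_reflection _ _
  generalize (ℝ ∙ (ℓ - t))ᗮ.reflection = R at hR hR'
  have h1 : a • R x = t - b • ℓ := by
    rw [eq_sub_iff_add_eq]
    calc a • R x + b • ℓ = R (a • x + b • t) := by rw [map_add, map_smul, map_smul, hR']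
      _ = t := by rw [← hab, hR]
  refine smul_right_injective E ha ?_
  simp only
  rw [h1, hab]
  have h3 : a * (a * ‖x‖ ^ 2) = 1 - b ^ 2 := by linarith
  rw [smul_sub, smul_smul, h3]
  module

theorem integral_abs_inner_rpow_mul_orthogonal_le [NeZero n] {q : ℝ} (hq : 0 ≤ q) {w : ℝ → ℝ}
    (hw : Continuous w) {x : EuclideanSpace ℝ (Fin n)} (hx : x ≠ 0)
    (hmono : ∀ s t, |s| ≤ |t| → |t| ≤ ‖x‖ → w s ≤ w t)
    {t ℓ : EuclideanSpace ℝ (Fin n)} (ht : ‖t‖ = 1) (hxt : inner ℝ t x = 0) (hℓ : ‖ℓ‖ = 1) :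
    ∫ η, |inner ℝ (η : EuclideanSpace ℝ (Fin n)) t| ^ q *
        w (inner ℝ (η : EuclideanSpace ℝ (Fin n)) x) ∂(sphereMeasure n) ≤
      ∫ η, |inner ℝ (η : EuclideanSpace ℝ (Fin n)) ℓ| ^ q *
        w (inner ℝ (η : EuclideanSpace ℝ (Fin n)) x) ∂(sphereMeasure n) := by
  by_cases hℓx : inner ℝ ℓ x = 0
  · exact integral_abs_inner_rpow_mul_le_of_orthogonal hq hw hmono hℓ ht hℓx hxt
  obtain ⟨t₀, a, b, ht₀, hxt₀, hab⟩ := exists_orthogonal_decomposition hx ht hxt ℓ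
  refine (integral_abs_inner_rpow_mul_le_of_orthogonal hq hw hmono ht₀ ht hxt₀ hxt).trans ?_
  have ha : a ≠ 0 := by
    rintro rfl
    apply hℓx
    rw [hab, zero_smul, zero_add, real_inner_smul_left, hxt₀, mul_zero]
  have hnorm : a ^ 2 * ‖x‖ ^ 2 + b ^ 2 = 1 := by
    have h := norm_add_sq_real (a • x) (b • t₀)
    rw [← hab, hℓ, norm_smul, norm_smul, ht₀, real_inner_smul_left, real_inner_smul_right,
      real_inner_comm, hxt₀, mul_pow, mul_pow, Real.norm_eq_abs, Real.norm_eq_abs, sq_abs,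
      sq_abs] at h
    linarith
  have he : ‖ℓ‖ = ‖t₀‖ := by rw [hℓ, ht₀]
  refine integral_abs_inner_rpow_mul_le hq hw hmono he (sq_nonneg ‖x‖) fun η ↦ ?_
  have hRx := reflection_sub_apply_of_eq he ha hnorm hab
  have hin : inner ℝ η ℓ = a * inner ℝ η x + b * inner ℝ η t₀ := by
    rw [hab, inner_add_right, inner_smul_right, inner_smul_right]
  rw [hRx, hin, inner_sub_right, inner_smul_right, inner_smul_right]
  linear_combination -(inner ℝ η t₀ ^ 2 * ‖x‖ ^ 2 + inner ℝ η x ^ 2) * hnorm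

end Comparison

section Weight

theorem _root_.ConvexOn.add_sub_le_add_sub {f : ℝ → ℝ} (hf : ConvexOn ℝ (Ici 0) f) {u s t : ℝ}
    (hst : |s| ≤ |t|) (htu : |t| ≤ u) : f (u + s) + f (u - s) ≤ f (u + t) + f (u - t) := by
  obtain ⟨k, hk, rfl⟩ : ∃ k : ℝ, |k| ≤ 1 ∧ s = k * t := by
    rcases eq_or_ne t 0 with rfl | ht
    · exact ⟨0, by simp, by simpa using hst⟩
    · exact ⟨s / t, by rw [abs_div]; exact div_le_one_of_le₀ hst (abs_nonneg _), by field_simp⟩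
  obtain ⟨hk1, hk2⟩ := abs_le.1 hk
  obtain ⟨ht1, ht2⟩ := abs_le.1 htu
  have hp : u + t ∈ Ici (0 : ℝ) := by simp only [mem_Ici]; linarith
  have hm : u - t ∈ Ici (0 : ℝ) := by simp only [mem_Ici]; linarith
  have h1 := hf.2 hp hm (show 0 ≤ (1 + k) / 2 by linarith) (show 0 ≤ (1 - k) / 2 by linarith) (by ring)
  have h2 := hf.2 hp hm (show 0 ≤ (1 - k) / 2 by linarith) (show 0 ≤ (1 + k) / 2 by linarith) (by ring)
  simp only [smul_eq_mul] at h1 h2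
  rw [show (1 + k) / 2 * (u + t) + (1 - k) / 2 * (u - t) = u + k * t by ring] at h1
  rw [show (1 - k) / 2 * (u + t) + (1 + k) / 2 * (u - t) = u - k * t by ring] at h2
  linarith

/-- The even part of the weight, as a function of `s = ⟪η, x⟫`. -/
noncomputable def evenWeight (α r s : ℝ) : ℝ :=
  ((1 + r ^ 2 + 2 * s) ^ α + (1 + r ^ 2 - 2 * s) ^ α) / 2

theorem continuous_evenWeight {α : ℝ} (hα : 0 ≤ α) (r : ℝ) : Continuous (evenWeight α r) := by
  unfold evenWeight
  exact ((Continuous.rpow_const (by fun_prop) fun _ ↦ Or.inr hα).add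
    (Continuous.rpow_const (by fun_prop) fun _ ↦ Or.inr hα)).div_const 2

theorem two_mul_abs_le_one_add_sq {r s : ℝ} (h : |s| ≤ r) : |2 * s| ≤ 1 + r ^ 2 := by
  rw [abs_mul, abs_two]
  nlinarith [sq_nonneg (r - 1)]

theorem evenWeight_le {α r s t : ℝ} (hα : α = 0 ∨ 1 ≤ α) (hst : |s| ≤ |t|) (ht : |t| ≤ r) :
    evenWeight α r s ≤ evenWeight α r t := by
  rcases hα with rfl | hα
  · simp [evenWeight]
  · have := (convexOn_rpow hα).add_sub_le_add_sub (s := 2 * s) (t := 2 * t)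
      (by simpa [abs_mul] using hst) (two_mul_abs_le_one_add_sq ht)
    unfold evenWeight
    linarith

theorem evenWeight_le_of_le_one {α r s t : ℝ} (hα0 : 0 ≤ α) (hα : α ≤ 1) (hst : |s| ≤ |t|)
    (ht : |t| ≤ r) : evenWeight α r t ≤ evenWeight α r s := by
  have := (Real.concaveOn_rpow hα0 hα).neg.add_sub_le_add_sub (s := 2 * s) (t := 2 * t)
    (by simpa [abs_mul] using hst) (two_mul_abs_le_one_add_sq ht)
  simp only [Pi.neg_apply] at this
  unfold evenWeight
  linarith

end Weight

section Extremal

variable {n : ℕ}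

theorem sphereFunctional_eq [NeZero n] {q α : ℝ} (hq : 0 ≤ q) (hα : 0 ≤ α)
    (x ℓ : EuclideanSpace ℝ (Fin n)) :
    sphereFunctional q α x ℓ = ∫ η, |inner ℝ (η : EuclideanSpace ℝ (Fin n)) ℓ| ^ q *
        evenWeight α ‖x‖ (inner ℝ (η : EuclideanSpace ℝ (Fin n)) x) ∂(sphereMeasure n) := by
  have h1 : sphereFunctional q α x ℓ = ∫ η, |inner ℝ (η : EuclideanSpace ℝ (Fin n)) ℓ| ^ q *
      (1 + ‖x‖ ^ 2 + 2 * inner ℝ (η : EuclideanSpace ℝ (Fin n)) x) ^ α ∂(sphereMeasure n) := by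
    refine integral_congr_ae (.of_forall fun η ↦ ?_)
    have hη : ‖(η : EuclideanSpace ℝ (Fin n))‖ = 1 := by simp
    simp only [norm_add_sq_real, hη]
    congr 2
    ring
  have h2 := integral_sphereMeasure_comp_isometry (n := n) (LinearIsometryEquiv.neg ℝ)
    (fun η ↦ |inner ℝ η ℓ| ^ q * (1 + ‖x‖ ^ 2 + 2 * inner ℝ η x) ^ α)
  simp only [LinearIsometryEquiv.coe_neg, inner_neg_left, abs_neg, mul_neg, ← sub_eq_add_neg] at h2
  have i1 := integrable_abs_inner_rpow_mul hq (w := fun s ↦ (1 + ‖x‖ ^ 2 + 2 * s) ^ α)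
    (Continuous.rpow_const (by fun_prop) fun _ ↦ Or.inr hα) x ℓ
  have i2 := integrable_abs_inner_rpow_mul hq (w := fun s ↦ (1 + ‖x‖ ^ 2 - 2 * s) ^ α)
    (Continuous.rpow_const (by fun_prop) fun _ ↦ Or.inr hα) x ℓ
  have h3 : sphereFunctional q α x ℓ =
      (sphereFunctional q α x ℓ + sphereFunctional q α x ℓ) / 2 := by ring
  rw [h3]
  nth_rw 2 [h1]
  rw [← h2, h1, ← integral_add i1 i2, ← integral_div]
  refine integral_congr_ae (.of_forall fun η ↦ ?_)
  simp only [evenWeight]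
  ring

variable [NeZero n] {x ℓ t : EuclideanSpace ℝ (Fin n)} {q α : ℝ}

theorem sphereFunctional_le_radial (hq : 0 ≤ q) (hα : α = 0 ∨ 1 ≤ α) (hx : x ≠ 0) (hℓ : ‖ℓ‖ = 1) :
    sphereFunctional q α x ℓ ≤ sphereFunctional q α x (‖x‖⁻¹ • x) := by
  have hα0 : 0 ≤ α := by rcases hα with h | h <;> linarith
  rw [sphereFunctional_eq hq hα0, sphereFunctional_eq hq hα0]
  exact integral_abs_inner_rpow_mul_le_radial hq (continuous_evenWeight hα0 _) hx
    (fun _ _ ↦ evenWeight_le hα) hℓ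

theorem sphereFunctional_orthogonal_le (hq : 0 ≤ q) (hα : α = 0 ∨ 1 ≤ α) (hx : x ≠ 0)
    (ht : ‖t‖ = 1) (hxt : inner ℝ t x = 0) (hℓ : ‖ℓ‖ = 1) :
    sphereFunctional q α x t ≤ sphereFunctional q α x ℓ := by
  have hα0 : 0 ≤ α := by rcases hα with h | h <;> linarith
  rw [sphereFunctional_eq hq hα0, sphereFunctional_eq hq hα0]
  exact integral_abs_inner_rpow_mul_orthogonal_le hq (continuous_evenWeight hα0 _) hx
    (fun _ _ ↦ evenWeight_le hα) ht hxt hℓ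

theorem sphereFunctional_radial_le (hq : 0 ≤ q) (hα0 : 0 ≤ α) (hα : α ≤ 1) (hx : x ≠ 0)
    (hℓ : ‖ℓ‖ = 1) : sphereFunctional q α x (‖x‖⁻¹ • x) ≤ sphereFunctional q α x ℓ := by
  rw [sphereFunctional_eq hq hα0, sphereFunctional_eq hq hα0]
  have := integral_abs_inner_rpow_mul_le_radial hq (continuous_evenWeight hα0 ‖x‖).neg hx
    (fun _ _ h h' ↦ neg_le_neg (evenWeight_le_of_le_one hα0 hα h h')) hℓ
  simpa [integral_neg] using this

theorem sphereFunctional_le_orthogonal (hq : 0 ≤ q) (hα0 : 0 ≤ α) (hα : α ≤ 1) (hx : x ≠ 0)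
    (ht : ‖t‖ = 1) (hxt : inner ℝ t x = 0) (hℓ : ‖ℓ‖ = 1) :
    sphereFunctional q α x ℓ ≤ sphereFunctional q α x t := by
  rw [sphereFunctional_eq hq hα0, sphereFunctional_eq hq hα0]
  have := integral_abs_inner_rpow_mul_orthogonal_le hq (continuous_evenWeight hα0 ‖x‖).neg hx
    (fun _ _ h h' ↦ neg_le_neg (evenWeight_le_of_le_one hα0 hα h h')) ht hxt hℓ
  simpa [integral_neg] using this

end Extremal

section Constants

variable {n : ℕ} {p : ℝ≥0∞}

theorem conjExp_sub_one (hp : 1 < p) (hp' : p ≠ ∞) : conjExp p - 1 = (p.toReal - 1)⁻¹ := by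
  have h := one_lt_toReal hp hp'
  have h1 : p.toReal - 1 ≠ 0 := by linarith
  have h2 : 1 - p.toReal⁻¹ = (p.toReal - 1) / p.toReal := by field_simp
  rw [conjExp, h2, inv_div]
  field_simp
  ring

theorem weightExp_nonneg (hp : 1 < p) : 0 ≤ ((n - 1 : ℕ) : ℝ) * (conjExp p - 1) :=
  mul_nonneg (Nat.cast_nonneg _) (by linarith [one_le_conjExp hp])

theorem one_le_weightExp [NeZero n] (hp : 1 < p) (hpn : p ≤ n) :
    1 ≤ ((n - 1 : ℕ) : ℝ) * (conjExp p - 1) := by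
  have hp' : p ≠ ∞ := (hpn.trans_lt (ENNReal.natCast_lt_top n)).ne
  have h := one_lt_toReal hp hp'
  have h1 : p.toReal ≤ n := by
    simpa using ENNReal.toReal_mono (ENNReal.natCast_ne_top n) hpn
  rw [conjExp_sub_one hp hp', Nat.cast_pred (Nat.pos_of_neZero n), ← div_eq_mul_inv,
    one_le_div (by linarith)]
  linarith

theorem weightExp_le_one [NeZero n] (hp : 1 < p) (hpn : n ≤ p) :
    ((n - 1 : ℕ) : ℝ) * (conjExp p - 1) ≤ 1 := by
  by_cases hp' : p = ∞
  · rw [hp', conjExp_top, sub_self, mul_zero]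
    exact zero_le_one
  have h := one_lt_toReal hp hp'
  have h1 : n ≤ p.toReal := by simpa using ENNReal.toReal_mono hp' hpn
  rw [conjExp_sub_one hp hp', Nat.cast_pred (Nat.pos_of_neZero n), ← div_eq_mul_inv,
    div_le_one (by linarith)]
  linarith

theorem exists_unit_orthogonal (hn : 2 ≤ n) (x : EuclideanSpace ℝ (Fin n)) :
    ∃ t : EuclideanSpace ℝ (Fin n), ‖t‖ = 1 ∧ inner ℝ t x = 0 := by
  have hne : (ℝ ∙ x)ᗮ ≠ ⊥ := by
    intro h
    rw [Submodule.orthogonal_eq_bot_iff] at h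
    have h1 := finrank_span_le_card (R := ℝ) {x}
    rw [h, finrank_top, finrank_euclideanSpace_fin, toFinset_singleton, Finset.card_singleton] at h1
    omega
  obtain ⟨v, hv, hv0⟩ := Submodule.exists_mem_ne_zero_of_ne_bot hne
  refine ⟨‖v‖⁻¹ • v, norm_inv_smul_self hv0, ?_⟩
  rw [real_inner_smul_left, Submodule.mem_orthogonal_singleton_iff_inner_left.1 hv, mul_zero]

theorem isLeast_gradBounds [NeZero n] {x ℓ₀ : EuclideanSpace ℝ (Fin n)} (hx : ‖x‖ < 1) (hp : 1 < p)
    (hℓ₀ : ‖ℓ₀‖ = 1) (hmax : ∀ ℓ, ‖ℓ‖ = 1 → dirConst p x ℓ ≤ dirConst p x ℓ₀) :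
    IsLeast (gradBounds p x) (dirConst p x ℓ₀) := by
  constructor
  · intro φ hφ
    set g := gradient (poissonIntegral φ) x
    by_cases hg : g = 0
    · rw [hg, norm_zero]
      exact (abs_nonneg _).trans ((isLeast_dirConst hx hp ℓ₀).1 φ hφ)
    · have hu := norm_inv_smul_self hg
      have h := (isLeast_dirConst hx hp (‖g‖⁻¹ • g)).1 φ hφ
      have h1 : |inner ℝ g (‖g‖⁻¹ • g)| = ‖g‖ := by
        have := norm_ne_zero_iff.2 hg
        rw [real_inner_smul_right, real_inner_self_eq_norm_sq, sq, inv_mul_cancel_left₀ this,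
          abs_norm]
      rw [h1] at h
      exact h.trans (mul_le_mul_of_nonneg_right (hmax _ hu) ENNReal.toReal_nonneg)
  · intro C hC
    refine (isLeast_dirConst hx hp ℓ₀).2 fun φ hφ ↦ ?_
    refine (abs_real_inner_le_norm _ _).trans ?_
    rw [hℓ₀, mul_one]
    exact hC φ hφ

theorem gradConst_eq [NeZero n] {x ℓ₀ : EuclideanSpace ℝ (Fin n)} (hx : ‖x‖ < 1) (hp : 1 < p)
    (hℓ₀ : ‖ℓ₀‖ = 1) (hmax : ∀ ℓ, ‖ℓ‖ = 1 → dirConst p x ℓ ≤ dirConst p x ℓ₀) :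
    gradConst p x = dirConst p x ℓ₀ :=
  (isLeast_gradBounds hx hp hℓ₀ hmax).csInf_eq

end Constants

end HypKhavinson

open HypKhavinson
theorem mainTheorem1 (n : ℕ) (hn : 3 ≤ n) (p : ℝ≥0∞) (hp : 1 < p)
    (x : EuclideanSpace ℝ (Fin n)) (hx : ‖x‖ < 1) (hx0 : x ≠ 0) :
    -- the gradients exist and the optimal constants are attained
    (∀ φ : Metric.sphere (0 : EuclideanSpace ℝ (Fin n)) 1 → ℝ,
      MemLp φ p (sphereMeasure n) → DifferentiableAt ℝ (poissonIntegral φ) x) ∧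
    (∀ ℓ : EuclideanSpace ℝ (Fin n), ‖ℓ‖ = 1 → IsLeast (dirBounds p x ℓ) (dirConst p x ℓ)) ∧
    IsLeast (gradBounds p x) (gradConst p x) ∧
    -- the case `1 < p < n`
    (p < (n : ℝ≥0∞) →
      IsGreatest (dirConst p x '' Metric.sphere 0 1) (dirConst p x (‖x‖⁻¹ • x)) ∧
      (∀ t : EuclideanSpace ℝ (Fin n), ‖t‖ = 1 → inner ℝ t x = 0 →
        IsLeast (dirConst p x '' Metric.sphere 0 1) (dirConst p x t)) ∧
      gradConst p x = dirConst p x (‖x‖⁻¹ • x)) ∧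
    -- the case `p > n`
    ((n : ℝ≥0∞) < p →
      IsLeast (dirConst p x '' Metric.sphere 0 1) (dirConst p x (‖x‖⁻¹ • x)) ∧
      (∀ t : EuclideanSpace ℝ (Fin n), ‖t‖ = 1 → inner ℝ t x = 0 →
        IsGreatest (dirConst p x '' Metric.sphere 0 1) (dirConst p x t) ∧
        gradConst p x = dirConst p x t)) ∧
    -- the cases `p = n` and `p = ∞`
    (p = (n : ℝ≥0∞) ∨ p = ∞ →
      ∀ ℓ : EuclideanSpace ℝ (Fin n), ‖ℓ‖ = 1 →
        (∀ ℓ' : EuclideanSpace ℝ (Fin n), ‖ℓ'‖ = 1 → dirConst p x ℓ = dirConst p x ℓ') ∧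
        gradConst p x = dirConst p x ℓ) := by
  have : NeZero n := ⟨by omega⟩
  have hq : 0 ≤ conjExp p := zero_le_one.trans (one_le_conjExp hp)
  have hα0 : 0 ≤ ((n - 1 : ℕ) : ℝ) * (conjExp p - 1) := weightExp_nonneg hp
  have he : ‖‖x‖⁻¹ • x‖ = 1 := norm_inv_smul_self hx0
  have radial_max (h : ((n - 1 : ℕ) : ℝ) * (conjExp p - 1) = 0 ∨
      1 ≤ ((n - 1 : ℕ) : ℝ) * (conjExp p - 1)) (ℓ) (hℓ : ‖ℓ‖ = 1) :
      dirConst p x ℓ ≤ dirConst p x (‖x‖⁻¹ • x) :=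
    dirConst_le_dirConst hx hp (sphereFunctional_le_radial hq h hx0 hℓ)
  have radial_min (h : (n : ℝ≥0∞) ≤ p) (ℓ) (hℓ : ‖ℓ‖ = 1) :
      dirConst p x (‖x‖⁻¹ • x) ≤ dirConst p x ℓ :=
    dirConst_le_dirConst hx hp
      (sphereFunctional_radial_le hq hα0 (weightExp_le_one hp h) hx0 hℓ)
  have orth_max (h : (n : ℝ≥0∞) ≤ p) (t) (ht : ‖t‖ = 1) (hxt : inner ℝ t x = 0) (ℓ)
      (hℓ : ‖ℓ‖ = 1) : dirConst p x ℓ ≤ dirConst p x t :=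
    dirConst_le_dirConst hx hp
      (sphereFunctional_le_orthogonal hq hα0 (weightExp_le_one hp h) hx0 ht hxt hℓ)
  refine ⟨fun φ hφ ↦ (hasFDerivAt_poissonIntegral hx (hφ.integrable hp.le)).differentiableAt,
    fun ℓ _ ↦ isLeast_dirConst hx hp ℓ, ?_, ?_, ?_, ?_⟩
  · obtain ⟨ℓ₀, hℓ₀, hmax⟩ : ∃ ℓ₀ : EuclideanSpace ℝ (Fin n), ‖ℓ₀‖ = 1 ∧
        ∀ ℓ, ‖ℓ‖ = 1 → dirConst p x ℓ ≤ dirConst p x ℓ₀ := by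
      rcases le_total p n with h | h
      · exact ⟨_, he, radial_max (.inr (one_le_weightExp hp h))⟩
      · obtain ⟨t, ht, hxt⟩ := exists_unit_orthogonal (by omega) x
        exact ⟨t, ht, orth_max h t ht hxt⟩
    rw [gradConst_eq hx hp hℓ₀ hmax]
    exact isLeast_gradBounds hx hp hℓ₀ hmax
  · intro hpn
    have hα := one_le_weightExp hp hpn.le
    refine ⟨⟨⟨_, by simpa using he, rfl⟩, ?_⟩, fun t ht hxt ↦ ⟨⟨t, by simpa using ht, rfl⟩, ?_⟩,
      gradConst_eq hx hp he (radial_max (.inr hα))⟩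
    · rintro _ ⟨ℓ, hℓ, rfl⟩
      exact radial_max (.inr hα) ℓ (by simpa using hℓ)
    · rintro _ ⟨ℓ, hℓ, rfl⟩
      exact dirConst_le_dirConst hx hp
        (sphereFunctional_orthogonal_le hq (.inr hα) hx0 ht hxt (by simpa using hℓ))
  · intro hpn
    refine ⟨⟨⟨_, by simpa using he, rfl⟩, ?_⟩, fun t ht hxt ↦
      ⟨⟨⟨t, by simpa using ht, rfl⟩, ?_⟩, gradConst_eq hx hp ht (orth_max hpn.le t ht hxt)⟩⟩
    · rintro _ ⟨ℓ, hℓ, rfl⟩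
      exact radial_min hpn.le ℓ (by simpa using hℓ)
    · rintro _ ⟨ℓ, hℓ, rfl⟩
      exact orth_max hpn.le t ht hxt ℓ (by simpa using hℓ)
  · intro hpn
    have hconst : ∀ ℓ, ‖ℓ‖ = 1 → dirConst p x ℓ = dirConst p x (‖x‖⁻¹ • x) := by
      intro ℓ hℓ
      rcases hpn with h | h
      · exact (radial_max (.inr (one_le_weightExp hp h.le)) ℓ hℓ).antisymm (radial_min h.ge ℓ hℓ)
      · refine (radial_max (.inl ?_) ℓ hℓ).antisymm (radial_min (h ▸ le_top) ℓ hℓ)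
        rw [h, conjExp_top, sub_self, mul_zero]
    intro ℓ hℓ
    exact ⟨fun ℓ' hℓ' ↦ (hconst ℓ hℓ).trans (hconst ℓ' hℓ').symm,
      gradConst_eq hx hp hℓ fun ℓ' hℓ' ↦ ((hconst ℓ' hℓ').trans (hconst ℓ hℓ).symm).le⟩
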